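/- Let $m,q,k\ge 1$ be integers and let $\Omega$ be an alphabet with $|\Omega|=q$. A $k$-mer is a word of length $k$ over $\Omega$. Let $\mathcal{L}(m,q,k)$ be the set of linear multi de Bruijn sequences, i.e. words over $\Omega$ of length $mq^k+k-1$ in which every $k$-mer occurs (as a block of consecutive letters, overlaps allowed) exactly $m$ times. Let $\mathcal{LC}(m,q,k)$ be the set of linearized cyclic multi de Bruijn sequences, i.e. words $s$ such that every $k$-mer occurs exactly $m$ times in the cyclic sequence $(s)$; here occurrences are counted by their starting positions in $s$ and are read around the circle, positions of $s$ being reused if $k$ exceeds the length of $s$. For a $k$-mer $y$, let $\mathcal{L}_y(m,q,k)$ and $\mathcal{LC}_y(m,q,k)$ be the subsets of sequences that start with $y$ (read around the circle in the second case). Put $$W(m,q,k)=\frac{(mq)!^{\,q^{k-1}}}{m!^{\,q^k}}.$$ (a) If $q\ge 2$, then for every $s'\in\mathcal{L}(m,q,k)$ the first $k-1$ letters and the last $k-1$ letters of $s'$ form the same $(k-1)$-mer. (b) If $q\ge 2$, then dropping the last $k-1$ letters is a bijection $\mathcal{L}(m,q,k)\to\mathcal{LC}(m,q,k)$, whose inverse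 appends to $s$ a copy of its first $k-1$ letters. (c) For all $q\ge 1$ and every $k$-mer $y$, $|\mathcal{L}_y(m,q,k)|=|\mathcal{LC}_y(m,q,k)|$ and $$|\mathcal{L}(m,q,k)|=|\mathcal{LC}(m,q,k)|=q^k\cdot|\mathcal{LC}_y(m,q,k)|=W(m,q,k).$$ -/

import Mathlib

namespace MultiDeBruijn

/-- Number of occurrences of the word `y` in the linear sequence `s`: the number of
starting positions `i` such that the part of `s` from position `i` on begins with `y`.
Overlapping occurrences count; there is no wrapping around. -/
def linOcc {Ω : Type*} [DecidableEq Ω] (y s : List Ω) : ℕ :=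
  ((Finset.range (s.length + 1)).filter fun i => y <+: s.drop i).card

/-- The word `y` occurs circularly in `s` at position `i`: reading `s` around the circle from
position `i` spells `y`. When `y` is longer than `s`, positions of `s` are reused. -/
def CycOccAt {Ω : Type*} (y s : List Ω) (i : ℕ) : Prop :=
  ∀ j < y.length, s[(i + j) % s.length]? = y[j]?

instance {Ω : Type*} [DecidableEq Ω] (y s : List Ω) : DecidablePred (CycOccAt y s) := fun i =>
  inferInstanceAs (Decidable (∀ j < y.length, s[(i + j) % s.length]? = y[j]?))

/-- Number of positions of `s`, read around the circle, at which `y` occurs. -/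
def cycOccList {Ω : Type*} [DecidableEq Ω] (y s : List Ω) : ℕ :=
  ((Finset.range s.length).filter fun i => CycOccAt y s i).card

theorem cycOccList_rotate {Ω : Type*} [DecidableEq Ω] (y s : List Ω) (r : ℕ) :
    cycOccList y (s.rotate r) = cycOccList y s := by
  rcases Nat.eq_zero_or_pos s.length with h0 | hpos
  · rw [List.length_eq_zero_iff] at h0
    subst h0
    simp
  have key : ∀ i, CycOccAt y (s.rotate r) i ↔ CycOccAt y s (i + r) := by
    intro i
    unfold CycOccAt
    refine forall₂_congr fun j _ => ?_
    rw [List.length_rotate, List.getElem?_rotate (Nat.mod_lt _ hpos), Nat.mod_add_mod,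
      Nat.add_right_comm]
  have hper : Function.Periodic (CycOccAt y s) s.length := by
    intro i
    unfold CycOccAt
    refine propext (forall₂_congr fun j _ => ?_)
    rw [Nat.add_right_comm, Nat.add_mod_right]
  have h1 := Nat.filter_Ico_card_eq_of_periodic r s.length (CycOccAt y s) hper
  have h2 := Nat.filter_Ico_card_eq_of_periodic 0 s.length (CycOccAt y s) hper
  unfold cycOccList
  rw [List.length_rotate, Finset.range_eq_Ico]
  rw [Nat.zero_add] at h2
  rw [h2, ← h1]
  refine Finset.card_bij (fun i _ => i + r) ?_ ?_ ?_
  · intro i hi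
    simp only [Finset.mem_filter, Finset.mem_Ico, key] at hi ⊢
    exact ⟨⟨by omega, by omega⟩, hi.2⟩
  · intro a _ b _ h
    omega
  · intro b hb
    simp only [Finset.mem_filter, Finset.mem_Ico] at hb
    refine ⟨b - r, ?_, by omega⟩
    simp only [Finset.mem_filter, Finset.mem_Ico, key]
    exact ⟨⟨by omega, by omega⟩, by rw [Nat.sub_add_cancel hb.1.1]; exact hb.2⟩

/-- Number of occurrences of the word `y` in the cyclic sequence `c` (a list up to rotation). -/
def cycOcc {Ω : Type*} [DecidableEq Ω] (y : List Ω) (c : Cycle Ω) : ℕ :=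
  Quotient.lift (cycOccList y)
    (by
      rintro s _ ⟨r, rfl⟩
      exact (cycOccList_rotate y s r).symm) c

/-- Linear multi de Bruijn sequences over `Ω`: linear sequences of length `m q ^ k + k - 1`
(with `q = |Ω|`) in which every `k`-mer occurs exactly `m` times. -/
def linearSeqs (Ω : Type*) [Fintype Ω] [DecidableEq Ω] (m k : ℕ) : Set (List Ω) :=
  {s | s.length = m * Fintype.card Ω ^ k + (k - 1) ∧
    ∀ y : List Ω, y.length = k → linOcc y s = m}

/-- Linear multi de Bruijn sequences that start with the word `y`. -/
def linearSeqsFrom (Ω : Type*) [Fintype Ω] [DecidableEq Ω] (m k : ℕ) (y : List Ω) :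
    Set (List Ω) :=
  {s ∈ linearSeqs Ω m k | y <+: s}

/-- Cyclic multi de Bruijn sequences: cyclic sequences in which every `k`-mer occurs exactly
`m` times. -/
def cyclicSeqs (Ω : Type*) [DecidableEq Ω] (m k : ℕ) : Set (Cycle Ω) :=
  {c | ∀ y : List Ω, y.length = k → cycOcc y c = m}

/-- Linearized cyclic multi de Bruijn sequences: the linearizations (representatives) of the
cyclic multi de Bruijn sequences. -/
def linearizedSeqs (Ω : Type*) [DecidableEq Ω] (m k : ℕ) : Set (List Ω) :=
  {s | ∃ c ∈ cyclicSeqs Ω m k, (s : Cycle Ω) = c}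

/-- Linearized cyclic multi de Bruijn sequences that start with the word `y` (where `s` is
read around the circle in case `y` is longer than `s`). -/
def linearizedSeqsFrom (Ω : Type*) [DecidableEq Ω] (m k : ℕ) (y : List Ω) : Set (List Ω) :=
  {s ∈ linearizedSeqs Ω m k | CycOccAt y s 0}

/-- `W(m,q,k) = (mq)! ^ (q ^ (k-1)) / m! ^ (q ^ k)`. -/
def W (m q k : ℕ) : ℚ :=
  ((m * q).factorial : ℚ) ^ (q ^ (k - 1)) / (m.factorial : ℚ) ^ (q ^ k)

end MultiDeBruijn

namespace MultiDeBruijn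

set_option linter.unusedSectionVars false

/-! ### Words with prescribed transition counts: Whittle's formula. -/

section Trails

variable {V Ω : Type*} [DecidableEq V] [DecidableEq Ω]

/-! Put `n = k - 1`. A word `v ++ x` with `|v| = n` is a walk on the de Bruijn graph of `n`-mers,
started at `v` and driven by `x`; its `k`-mers are the edges traversed. Linear multi de Bruijn
sequences are thus the trails using every edge exactly `m` times. All in- and out-degrees are then
`mq`, so such a trail is closed, which is (a). Unrolling a circle `n` letters beyond one turn
(`Wraps`) turns cyclic occurrences into linear ones and gives (b), as well as the equalities of
cardinalities in (c), also for `q = 1`.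

The count rests on Whittle's formula (`ncard_trails_mul_prod`): the number of trails with edge
counts `c` is a quotient of factorials times a cofactor of the normalised Laplacian. Instead of
passing through arborescences, it is proved by deleting the first edge: both sides satisfy the same
recursion (`ncard_trails`, `rootedDet_rec`).

For constant `c` the matrix is the uniform walk `P` on the de Bruijn graph. It forgets its starting
point after `n` steps, so `P` minus the uniform projection is nilpotent, and the cofactor is `1 / q
^ n` (`det_updateRow_one_sub`). Each starting `n`-mer therefore contributes `W / q ^ n`. Prescribing
the first edge as well leaves the cofactor unchanged and costs another factor `q`. -/

/-- The transition table that counts the single transition out of `v` labelled `a`. -/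
def unitCount (v : V) (a : Ω) : V → Ω → ℕ := fun u b => if u = v ∧ b = a then 1 else 0

/-- The number of times each transition of the automaton `δ` is used when it reads a word
starting in state `v`. -/
def transCount (δ : V → Ω → V) : V → List Ω → V → Ω → ℕ
  | _, [] => 0
  | v, a :: x => unitCount v a + transCount δ (δ v a) x

/-- The words that use each transition `(u, a)` exactly `c u a` times when read from `v`. -/
def trails (δ : V → Ω → V) (v : V) (c : V → Ω → ℕ) : Set (List Ω) :=
  {x | transCount δ v x = c}

variable [Fintype V] [Fintype Ω] (δ : V → Ω → V)

/-- The flow condition satisfied by the transition counts of a word leading from `v` to `t`. -/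
def Balanced (c : V → Ω → ℕ) (v t : V) : Prop :=
  ∀ u, ∑ b, c u b + (if u = t then 1 else 0) =
    ∑ p, ∑ b, (if δ p b = u then c p b else 0) + (if u = v then 1 else 0)

theorem balanced_unitCount_add (c : V → Ω → ℕ) (v t : V) (a : Ω) :
    Balanced δ (unitCount v a + c) v t ↔ Balanced δ c (δ v a) t := by
  unfold Balanced
  refine forall_congr' fun u => ?_
  have h1 : ∑ b, (unitCount v a + c) u b = (if u = v then 1 else 0) + ∑ b, c u b := by
    simp only [Pi.add_apply, Finset.sum_add_distrib, unitCount, ite_and]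
    congr 1
    split_ifs <;> simp
  have h2 : ∑ p, ∑ b, (if δ p b = u then (unitCount v a + c) p b else 0) =
      (if u = δ v a then 1 else 0) + ∑ p, ∑ b, (if δ p b = u then c p b else 0) := by
    have h3 : ∀ p b, (if δ p b = u then (unitCount v a + c) p b else 0) =
        (if p = v then (if b = a then (if u = δ v a then 1 else 0) else 0) else 0) +
          (if δ p b = u then c p b else 0) := by
      intro p b
      simp only [Pi.add_apply, unitCount]
      grind
    simp only [h3, Finset.sum_add_distrib]
    simp [Finset.sum_ite_irrel]
  rw [h1, h2]
  omega

theorem balanced_zero_iff (v t : V) : Balanced δ (0 : V → Ω → ℕ) v t ↔ v = t := by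
  unfold Balanced
  constructor
  · intro h
    by_contra hne
    simpa [hne] using h v
  · rintro rfl u
    simp

theorem balanced_transCount (v : V) (x : List Ω) :
    Balanced δ (transCount δ v x) v (x.foldl δ v) := by
  induction x generalizing v with
  | nil => exact (balanced_zero_iff δ v v).2 rfl
  | cons a x ih => exact (balanced_unitCount_add δ _ v _ a).2 (ih _)

theorem sum_transCount (v : V) (x : List Ω) : ∑ u, ∑ b, transCount δ v x u b = x.length := by
  induction x generalizing v with
  | nil => simp [transCount]
  | cons a x ih =>
    simp only [transCount, Pi.add_apply, Finset.sum_add_distrib, ih, List.length_cons]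
    rw [add_comm]
    simp [unitCount, ite_and, Finset.sum_ite_irrel]

theorem trails_finite (v : V) (c : V → Ω → ℕ) : (trails δ v c).Finite := by
  refine (List.finite_length_eq Ω (∑ u, ∑ b, c u b)).subset ?_
  rintro x rfl
  exact (sum_transCount δ v x).symm

theorem unitCount_add_sub {c : V → Ω → ℕ} {v : V} {a : Ω} (h : 0 < c v a) :
    unitCount v a + (c - unitCount v a) = c := by
  ext u b
  simp only [Pi.add_apply, Pi.sub_apply, unitCount]
  split_ifs with h1
  · obtain ⟨rfl, rfl⟩ := h1
    omega
  · omega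

theorem cons_mem_trails {c : V → Ω → ℕ} {v : V} {a : Ω} {x : List Ω} :
    a :: x ∈ trails δ v c ↔ 0 < c v a ∧ x ∈ trails δ (δ v a) (c - unitCount v a) := by
  simp only [trails, Set.mem_ofPred_eq, transCount]
  constructor
  · rintro rfl
    refine ⟨by simp [unitCount], ?_⟩
    ext u b
    simp
  · rintro ⟨h1, h2⟩
    rw [h2, unitCount_add_sub h1]

theorem ncard_trails {c : V → Ω → ℕ} (hc : c ≠ 0) (v : V) :
    (trails δ v c).ncard =
      ∑ a, if 0 < c v a then (trails δ (δ v a) (c - unitCount v a)).ncard else 0 := by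
  classical
  have key : (trails_finite δ v c).toFinset = Finset.univ.biUnion fun a =>
      if 0 < c v a then
        (trails_finite δ (δ v a) (c - unitCount v a)).toFinset.image (List.cons a) else ∅ := by
    ext x
    simp only [Set.Finite.mem_toFinset, Finset.mem_biUnion, Finset.mem_univ, true_and]
    cases x with
    | nil =>
      constructor
      · intro h
        exact absurd h.symm hc
      · rintro ⟨a, ha⟩
        split_ifs at ha <;> simp at ha
    | cons a x =>
      rw [cons_mem_trails]
      constructor
      · rintro ⟨h1, h2⟩
        exact ⟨a, by simp [h1, h2]⟩
      · rintro ⟨b, hb⟩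
        split_ifs at hb with h1
        · simp only [Finset.mem_image, Set.Finite.mem_toFinset, List.cons.injEq] at hb
          obtain ⟨y, hy, rfl, rfl⟩ := hb
          exact ⟨h1, hy⟩
        · simp at hb
  rw [Set.ncard_eq_toFinset_card _ (trails_finite δ v c), key, Finset.card_biUnion]
  · refine Finset.sum_congr rfl fun a _ => ?_
    split_ifs
    · rw [Finset.card_image_of_injective _ (List.cons_injective),
        Set.ncard_eq_toFinset_card _ (trails_finite δ _ _)]
    · rfl
  · intro a _ b _ hab
    rw [Function.onFun, Finset.disjoint_left]
    intro x hx hy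
    split_ifs at hx hy <;> simp at hx hy
    obtain ⟨y, _, rfl⟩ := hx
    obtain ⟨z, _, hz⟩ := hy
    exact hab (by simpa using (List.cons.inj hz).1.symm)

theorem trails_zero (v : V) : trails δ v (0 : V → Ω → ℕ) = {[]} := by
  ext x
  cases x with
  | nil => simp [trails, transCount]
  | cons a x => simp [cons_mem_trails]

/-- The transition matrix obtained by normalising the rows of a transition table. -/
def transMatrix (c : V → Ω → ℕ) : Matrix V V ℚ :=
  Matrix.of fun u w => ∑ a, if δ u a = w then (c u a : ℚ) / ((∑ b, c u b : ℕ) : ℚ) else 0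

/-- The determinant of the normalised Laplacian of `c` with the row and column of `t` removed. -/
def rootedDet (c : V → Ω → ℕ) (t : V) : ℚ :=
  ((1 - transMatrix δ c).updateRow t (Pi.single t 1)).det

theorem rootedDet_congr {c c' : V → Ω → ℕ} {t : V} (h : ∀ u, u ≠ t → c u = c' u) :
    rootedDet δ c t = rootedDet δ c' t := by
  unfold rootedDet
  congr 1
  ext u w
  by_cases hu : u = t
  · subst hu; simp
  · simp [Matrix.updateRow_ne hu, transMatrix, h u hu]

theorem rootedDet_zero (t : V) : rootedDet δ (0 : V → Ω → ℕ) t = 1 := by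
  have h : (1 - transMatrix δ (0 : V → Ω → ℕ)).updateRow t (Pi.single t 1) = 1 := by
    ext u w
    by_cases hu : u = t
    · subst hu
      simp [Matrix.one_apply, Pi.single_apply, eq_comm]
    · simp [Matrix.updateRow_ne hu, transMatrix]
  rw [rootedDet, h, Matrix.det_one]

theorem count_mul_transMatrix (c : V → Ω → ℕ) (u w : V) :
    ((∑ b, c u b : ℕ) : ℚ) * transMatrix δ c u w = ∑ a, if δ u a = w then (c u a : ℚ) else 0 := by
  simp only [transMatrix, Matrix.of_apply, Finset.mul_sum]
  refine Finset.sum_congr rfl fun a _ => ?_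
  split_ifs
  · by_cases h : (∑ b, c u b) = 0
    · have : c u a = 0 := by
        rw [Finset.sum_eq_zero_iff] at h
        exact h a (Finset.mem_univ a)
      simp [this]
    · field_simp
  · simp

/-- This matches the absence of trails when edges remain but none leaves `v`. Balance forces `v =
t`, hence in-degree equals out-degree everywhere, and the vector of out-degrees is a left null
vector: its entry at the replaced row `t` is zero, so that row does no harm. -/
theorem rootedDet_eq_zero {c : V → Ω → ℕ} {v t : V} (hb : Balanced δ c v t) (hc : c ≠ 0)
    (hv : ∑ b, c v b = 0) : rootedDet δ c t = 0 := by
  have hvt : v = t := by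
    by_contra hne
    have := hb v
    simp [hne, hv] at this
  subst hvt
  rw [rootedDet, ← Matrix.exists_vecMul_eq_zero_iff]
  refine ⟨fun u => ((∑ b, c u b : ℕ) : ℚ), ?_, ?_⟩
  · contrapose! hc
    ext u a
    have := congrFun hc u
    simp only [Pi.zero_apply, Nat.cast_eq_zero, Finset.sum_eq_zero_iff] at this
    exact this a (Finset.mem_univ a)
  · ext w
    simp only [Matrix.vecMul, dotProduct, Pi.zero_apply]
    have h1 : ∀ u, ((∑ b, c u b : ℕ) : ℚ) *
        (1 - transMatrix δ c).updateRow v (Pi.single v 1) u w =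
        (if u = w then ((∑ b, c u b : ℕ) : ℚ) else 0) -
          ∑ a, if δ u a = w then (c u a : ℚ) else 0 := by
      intro u
      rw [← count_mul_transMatrix]
      by_cases hu : u = v
      · subst hu
        simp [hv]
      · rw [Matrix.updateRow_ne hu]
        simp [Matrix.one_apply, mul_sub]
    simp only [h1, Finset.sum_sub_distrib, Finset.sum_ite_eq', Finset.mem_univ, if_true]
    have h2 : ∑ b, c w b = ∑ p, ∑ b, (if δ p b = w then c p b else 0) := by
      have := hb w
      omega
    rw [h2]
    push_cast
    simp

theorem sum_mul_det_updateRow (X : Matrix V V ℚ) (v : V) (r : Ω → ℚ) (f : Ω → V → ℚ) :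
    ∑ a, r a * (X.updateRow v (f a)).det = (X.updateRow v (∑ a, r a • f a)).det := by
  simp only [← Matrix.cramer_transpose_apply, map_sum, map_smul, Finset.sum_apply, Pi.smul_apply,
    smul_eq_mul]

theorem sum_sub_unitCount {c : V → Ω → ℕ} {v : V} {a : Ω} (h : 0 < c v a) :
    ∑ b, (c - unitCount v a) v b + 1 = ∑ b, c v b := by
  conv_rhs => rw [← unitCount_add_sub h]
  simp only [Pi.add_apply, Finset.sum_add_distrib]
  simp [unitCount, add_comm]

theorem transMatrix_sub_unitCount_of_ne {c : V → Ω → ℕ} {v u : V} {a : Ω} (h : u ≠ v) :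
    transMatrix δ (c - unitCount v a) u = transMatrix δ c u := by
  ext w
  simp [transMatrix, unitCount, h]

/-- The average of the transition rows after the removal of one transition is the original row,
unless that transition is the last one. -/
theorem sum_transMatrix_sub_unitCount {c : V → Ω → ℕ} {v : V} (h : 1 < ∑ b, c v b) (w : V) :
    ∑ a, (c v a : ℚ) / ((∑ b, c v b : ℕ) : ℚ) * transMatrix δ (c - unitCount v a) v w =
      transMatrix δ c v w := by
  set C : ℚ := ((∑ b, c v b : ℕ) : ℚ) with hC
  have hC1 : (1 : ℚ) < C := by rw [hC]; exact_mod_cast h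
  have hC0 : C ≠ 0 := by linarith
  have hC2 : C - 1 ≠ 0 := by linarith
  have h1 : ∀ a, (c v a : ℚ) / C * transMatrix δ (c - unitCount v a) v w =
      ∑ b, if δ v b = w then
        (c v a : ℚ) / C * (((c v b : ℚ) - (if b = a then 1 else 0)) / (C - 1)) else 0 := by
    intro a
    rcases Nat.eq_zero_or_pos (c v a) with h0 | h0
    · simp [h0]
    · have h2 : ((∑ b, (c - unitCount v a) v b : ℕ) : ℚ) = C - 1 := by
        rw [hC, ← sum_sub_unitCount h0]
        push_cast
        ring
      simp only [transMatrix, Matrix.of_apply, Finset.mul_sum, h2]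
      refine Finset.sum_congr rfl fun b _ => ?_
      have h3 : (((c - unitCount v a) v b : ℕ) : ℚ) = (c v b : ℚ) - (if b = a then 1 else 0) := by
        conv_rhs => rw [← unitCount_add_sub h0]
        simp [unitCount]
      split_ifs <;> simp_all
  simp only [h1]
  rw [Finset.sum_comm]
  simp only [transMatrix, Matrix.of_apply]
  refine Finset.sum_congr rfl fun b _ => ?_
  split_ifs with hb
  · have h4 : ∀ a, (c v a : ℚ) / C * (((c v b : ℚ) - (if b = a then 1 else 0)) / (C - 1)) =
        (c v a : ℚ) * ((c v b : ℚ) / (C * (C - 1))) -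
          (if b = a then (c v a : ℚ) / (C * (C - 1)) else 0) := by
      intro a
      split_ifs
      all_goals field_simp
      all_goals ring
    simp only [h4, Finset.sum_sub_distrib, ← Finset.sum_mul, Finset.sum_ite_eq, Finset.mem_univ,
      if_true]
    have h5 : ∑ a, (c v a : ℚ) = C := by rw [hC]; push_cast; rfl
    rw [h5]
    rw [← hC]
    field_simp
  · simp

/-- Deleting an edge out of `v` changes only row `v`, and the determinant is linear in that row, so
the weighted sum is the determinant with the averaged row. If `v = t` the row is overwritten anyway.
The delicate case is the deletion of the last edge out of `v`. -/
theorem rootedDet_rec {c : V → Ω → ℕ} {v t : V} (hb : Balanced δ c v t)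
    (hv : 0 < ∑ b, c v b) :
    rootedDet δ c t =
      ∑ a, (c v a : ℚ) / ((∑ b, c v b : ℕ) : ℚ) * rootedDet δ (c - unitCount v a) t := by
  have hsum : ∑ a, (c v a : ℚ) / ((∑ b, c v b : ℕ) : ℚ) = 1 := by
    rw [← Finset.sum_div, ← Nat.cast_sum, div_self]
    exact_mod_cast hv.ne'
  by_cases hvt : v = t
  · subst hvt
    have h1 : ∀ a, rootedDet δ (c - unitCount v a) v = rootedDet δ c v := fun a =>
      rootedDet_congr δ fun u hu => by ext b; simp [unitCount, hu]
    simp only [h1]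
    rw [← Finset.sum_mul, hsum, one_mul]
  set X := (1 - transMatrix δ c).updateRow t (Pi.single t 1) with hX
  have h1 : ∀ a, rootedDet δ (c - unitCount v a) t =
      (X.updateRow v ((1 - transMatrix δ (c - unitCount v a)) v)).det := by
    intro a
    rw [rootedDet]
    congr 1
    ext u w
    by_cases hu : u = v
    · subst hu
      rw [Matrix.updateRow_ne hvt, Matrix.updateRow_self]
    · rw [Matrix.updateRow_ne hu, hX]
      by_cases hut : u = t
      · subst hut; simp
      · rw [Matrix.updateRow_ne hut, Matrix.updateRow_ne hut]
        simp [transMatrix_sub_unitCount_of_ne δ hu]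
  have h2 : rootedDet δ c t = (X.updateRow v ((1 - transMatrix δ c) v)).det := by
    rw [rootedDet, ← hX]
    congr 1
    conv_lhs => rw [← Matrix.updateRow_eq_self X v]
    rw [hX, Matrix.updateRow_ne hvt]
  simp only [h1]
  rw [sum_mul_det_updateRow, h2]
  have h3 : ∀ w, (∑ a, ((c v a : ℚ) / ((∑ b, c v b : ℕ) : ℚ)) •
      (1 - transMatrix δ (c - unitCount v a)) v) w = (1 : Matrix V V ℚ) v w -
      ∑ a, (c v a : ℚ) / ((∑ b, c v b : ℕ) : ℚ) * transMatrix δ (c - unitCount v a) v w := by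
    intro w
    simp only [Finset.sum_apply, Pi.smul_apply, Matrix.sub_apply, smul_eq_mul, mul_sub,
      Finset.sum_sub_distrib, ← Finset.sum_mul, hsum, one_mul]
  rcases Nat.lt_or_ge 1 (∑ b, c v b) with hgt | hle
  · congr 2
    ext w
    rw [h3, sum_transMatrix_sub_unitCount δ hgt]
    simp
  · have hone : ∑ b, c v b = 1 := by omega
    -- At `v ≠ t` the out-degree exceeds the in-degree by one, so nothing enters `v` and column `v`
    -- of the transition matrix vanishes.
    have hin : ∀ u a, δ u a = v → c u a = 0 := by
      have h4 := hb v
      simp only [hone, hvt, if_false, if_true, add_zero] at h4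
      have h5 : ∑ p, ∑ b, (if δ p b = v then c p b else 0) = 0 := by omega
      intro u a hua
      rw [Finset.sum_eq_zero_iff] at h5
      have h6 := Finset.sum_eq_zero_iff.1 (h5 u (Finset.mem_univ u)) a (Finset.mem_univ a)
      simpa [hua] using h6
    have hcol : ∀ u, transMatrix δ c u v = 0 := by
      intro u
      refine Finset.sum_eq_zero fun a _ => ?_
      split_ifs with h
      · simp [hin u a h]
      · rfl
    -- Once the last edge is gone, division by zero makes the transition row zero, so the averaged
    -- row is the unit vector at `v`. It differs from the original row by a transition row, whose
    -- determinant `h5` has a zero column.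
    have h4 : (∑ a, ((c v a : ℚ) / ((∑ b, c v b : ℕ) : ℚ)) •
        (1 - transMatrix δ (c - unitCount v a)) v) =
        (1 - transMatrix δ c) v + transMatrix δ c v := by
      ext w
      rw [h3]
      simp only [Pi.add_apply, Matrix.sub_apply, sub_add_cancel]
      rw [sub_eq_self]
      refine Finset.sum_eq_zero fun a _ => ?_
      rcases Nat.eq_zero_or_pos (c v a) with h0 | h0
      · simp [h0]
      · have h5 : ∑ b, (c - unitCount v a) v b = 0 := by
          have := sum_sub_unitCount h0
          omega
        simp only [transMatrix, Matrix.of_apply, h5]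
        simp
    rw [h4, Matrix.det_updateRow_add]
    have h5 : (X.updateRow v (transMatrix δ c v)).det = 0 := by
      refine Matrix.det_eq_zero_of_column_eq_zero v fun u => ?_
      by_cases hu : u = v
      · subst hu
        rw [Matrix.updateRow_self, hcol]
      · rw [Matrix.updateRow_ne hu, hX]
        by_cases hut : u = t
        · subst hut
          rw [Matrix.updateRow_self, Pi.single_eq_of_ne hvt]
        · rw [Matrix.updateRow_ne hut]
          simp [hcol, hu]
    rw [h5, add_zero]

theorem prod_factorial_sub_unitCount {c : V → Ω → ℕ} {v : V} {a : Ω} (h : 0 < c v a) :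
    ∏ u, ∏ b, (c u b).factorial =
      c v a * ∏ u, ∏ b, ((c - unitCount v a) u b).factorial := by
  rw [← Fintype.prod_prod_type', ← Fintype.prod_prod_type',
    ← Finset.mul_prod_erase _ _ (Finset.mem_univ (v, a)),
    ← Finset.mul_prod_erase (Finset.univ : Finset (V × Ω))
      (fun p : V × Ω => ((c - unitCount v a) p.1 p.2).factorial) (Finset.mem_univ (v, a)),
    ← mul_assoc]
  congr 1
  · simp [unitCount, Nat.mul_factorial_pred h.ne']
  · refine Finset.prod_congr rfl fun p hp => ?_
    have : ¬ (p.1 = v ∧ p.2 = a) := fun h => (Finset.mem_erase.1 hp).1 (Prod.ext h.1 h.2)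
    simp [unitCount, this]

theorem prod_factorial_sum_sub_unitCount {c : V → Ω → ℕ} {v : V} {a : Ω} (h : 0 < c v a) :
    ∏ u, (∑ b, c u b).factorial =
      (∑ b, c v b) * ∏ u, (∑ b, (c - unitCount v a) u b).factorial := by
  rw [← Finset.mul_prod_erase _ _ (Finset.mem_univ v),
    ← Finset.mul_prod_erase Finset.univ
      (fun u => (∑ b, (c - unitCount v a) u b).factorial) (Finset.mem_univ v), ← mul_assoc]
  congr 1
  · rw [← sum_sub_unitCount h, Nat.factorial_succ]
  · refine Finset.prod_congr rfl fun u hu => ?_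
    simp [unitCount, (Finset.mem_erase.1 hu).1]

/-- The number of words with prescribed transition counts (Whittle's formula). -/
theorem ncard_trails_mul_prod {c : V → Ω → ℕ} {v t : V} (hb : Balanced δ c v t) :
    ((trails δ v c).ncard : ℚ) * ((∏ u, ∏ b, (c u b).factorial : ℕ) : ℚ) =
      ((∏ u, (∑ b, c u b).factorial : ℕ) : ℚ) * rootedDet δ c t := by
  induction hN : ∑ u, ∑ b, c u b generalizing c v with
  | zero =>
    have hc : c = 0 := by
      ext u b
      exact Finset.sum_eq_zero_iff.1 (Finset.sum_eq_zero_iff.1 hN u (Finset.mem_univ u)) b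
        (Finset.mem_univ b)
    subst hc
    simp [trails_zero, rootedDet_zero]
  | succ N ih =>
    have hc : c ≠ 0 := by
      rintro rfl
      simp at hN
    rw [ncard_trails δ hc]
    rcases Nat.eq_zero_or_pos (∑ b, c v b) with h0 | hpos
    · rw [rootedDet_eq_zero δ hb hc h0]
      have : ∀ a, c v a = 0 := fun a => Finset.sum_eq_zero_iff.1 h0 a (Finset.mem_univ a)
      simp [this]
    · rw [rootedDet_rec δ hb hpos]
      push_cast
      rw [Finset.sum_mul, Finset.mul_sum]
      refine Finset.sum_congr rfl fun a _ => ?_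
      rcases Nat.eq_zero_or_pos (c v a) with ha | ha
      · simp [ha]
      · have hb' : Balanced δ (c - unitCount v a) (δ v a) t := by
          rwa [← balanced_unitCount_add, unitCount_add_sub ha]
        have hN' : ∑ u, ∑ b, (c - unitCount v a) u b = N := by
          rw [← unitCount_add_sub ha] at hN
          simp only [Pi.add_apply, Finset.sum_add_distrib] at hN
          have : ∑ u, ∑ b, unitCount v a u b = 1 := by
            simp [unitCount, ite_and, Finset.sum_ite_irrel]
          simp only [Pi.sub_apply] at hN ⊢
          omega
        have key := ih hb' hN'
        have e1 := prod_factorial_sub_unitCount ha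
        have e2 := prod_factorial_sum_sub_unitCount ha
        have hpos' : ((∑ b, c v b : ℕ) : ℚ) ≠ 0 := by exact_mod_cast hpos.ne'
        rw [if_pos ha]
        have e3 : (∏ u, ∏ b, ((c u b).factorial : ℚ)) =
            ((∏ u, ∏ b, (c u b).factorial : ℕ) : ℚ) := by push_cast; rfl
        have e4 : (∏ u, ((∑ b, c u b).factorial : ℚ)) =
            ((∏ u, (∑ b, c u b).factorial : ℕ) : ℚ) := by push_cast; rfl
        have e5 : (∑ b, (c v b : ℚ)) = ((∑ b, c v b : ℕ) : ℚ) := by push_cast; rfl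
        rw [e3, e4, e5, e1, e2, Nat.cast_mul, Nat.cast_mul]
        -- The weight `t / x` of the recursion is the ratio of the factors `t = c v a` and `x = ∑ b,
        -- c v b` split off from the two products of factorials.
        have : ∀ p q r s t x : ℚ, x ≠ 0 → p * q = r * s → p * (t * q) = x * r * (t / x * s) := by
          intro p q r s t x hx h
          field_simp
          linear_combination t * h
        exact this _ _ _ _ _ _ hpos' key

end Trails

/-! ### Laplacian cofactors of a doubly stochastic matrix. -/

theorem det_one_sub_of_isNilpotent {V : Type*} [Fintype V] [DecidableEq V] {B : Matrix V V ℚ}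
    (hB : IsNilpotent B) : (1 - B).det = 1 := by
  -- The characteristic polynomial of a nilpotent matrix is a power of `X`; evaluate it at `1`.
  have h := sub_eq_zero.1 (Matrix.isNilpotent_charpoly_sub_pow_of_isNilpotent hB).eq_zero
  have h1 := Matrix.eval_charpoly B 1
  rw [h] at h1
  simpa using h1.symm

/-- The principal cofactors of the Laplacian of a doubly stochastic matrix some power of which
has constant columns. -/
theorem det_updateRow_one_sub {V : Type*} [Fintype V] [DecidableEq V] {P : Matrix V V ℚ}
    (hrow : ∀ u, ∑ w, P u w = 1) (hcol : ∀ w, ∑ u, P u w = 1) {n : ℕ}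
    (hn : ∀ u u' w, (P ^ n) u w = (P ^ n) u' w) (t : V) :
    ((1 - P).updateRow t (Pi.single t 1)).det = 1 / (Fintype.card V : ℚ) := by
  have hN : (Fintype.card V : ℚ) ≠ 0 := by
    have : Nonempty V := ⟨t⟩
    exact_mod_cast Fintype.card_ne_zero
  set N : ℚ := (Fintype.card V : ℚ) with hNdef
  set E : Matrix V V ℚ := Matrix.of fun _ _ => 1 / N with hE
  have hPE : P * E = E := by
    ext u w
    simp [Matrix.mul_apply, hE, ← Finset.sum_mul, hrow]
  have hEP : E * P = E := by
    ext u w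
    simp [Matrix.mul_apply, hE, ← Finset.mul_sum, hcol]
  have hEE : E * E = E := by
    ext u w
    simp [Matrix.mul_apply, hE, ← hNdef, hN]
  have hEpow : ∀ j, E * P ^ j = E := by
    intro j
    induction j with
    | zero => simp
    | succ j ih => rw [pow_succ, ← mul_assoc, ih, hEP]
  have hPpow : P ^ n = E := by
    ext u w
    have h := congrFun (congrFun (hEpow n) u) w
    have h1 : ∀ x, (P ^ n) x w = (P ^ n) u w := fun x => hn x u w
    rw [Matrix.mul_apply] at h
    simp only [h1, hE, Matrix.of_apply, Finset.sum_const, Finset.card_univ, nsmul_eq_mul] at h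
    rw [hE, Matrix.of_apply, ← h, ← hNdef]
    field_simp
  -- `E` is idempotent and absorbs `P` on both sides. The identity needs a positive exponent, whence
  -- `n + 1` in `hnil`.
  have hBpow : ∀ j, (P - E) ^ (j + 1) = P ^ (j + 1) - E := by
    intro j
    induction j with
    | zero => simp
    | succ j ih =>
      have h1 : P ^ (j + 1) * E = E := by
        clear ih
        induction j with
        | zero => simpa using hPE
        | succ j ih => rw [pow_succ, mul_assoc, hPE, ih]
      rw [pow_succ, ih, sub_mul, mul_sub, mul_sub, h1, hEP, hEE, ← pow_succ]
      simp
  have hnil : IsNilpotent (P - E) := by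
    refine ⟨n + 1, ?_⟩
    rw [hBpow, pow_succ, hPpow, hEP, sub_self]
  have hdet := det_one_sub_of_isNilpotent hnil
  -- The rows of `1 - (P - E)` add up to the all-ones row, which may replace row `t` without
  -- changing the determinant.
  have h1 : ∑ k, (1 : ℚ) • (1 - (P - E)) k = fun _ => 1 := by
    funext w
    refine (Finset.sum_apply w _ _).trans ?_
    simp [Matrix.one_apply, Finset.sum_sub_distrib, hcol, hE, ← hNdef, hN]
  have h2 := Matrix.det_updateRow_sum (1 - (P - E)) t (fun _ => (1 : ℚ))
  rw [h1, hdet, one_smul] at h2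
  -- With row `t` all ones, the rows of `E` are multiples of it and can be subtracted away.
  have h3 : ((1 - (P - E)).updateRow t (fun _ => 1)).det =
      ((1 - P).updateRow t (fun _ => 1)).det := by
    refine Matrix.det_eq_of_forall_row_eq_smul_add_const (fun i => if i = t then 0 else 1 / N) t
      (by simp) fun i j => ?_
    by_cases hi : i = t
    · subst hi; simp
    · simp [hi, hE]
      ring
  -- With the difference of two unit vectors as row `t`, every row sums to zero, so the constant
  -- vector lies in the kernel. Hence all cofactors along row `t` agree, and their sum is `1`.
  have h4 : ∀ w, ((1 - P).updateRow t (Pi.single w 1)).det =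
      ((1 - P).updateRow t (Pi.single t 1)).det := by
    intro w
    rw [← sub_eq_zero, ← Matrix.cramer_transpose_apply, ← Matrix.cramer_transpose_apply,
      ← Pi.sub_apply, ← map_sub, Matrix.cramer_transpose_apply]
    refine Matrix.exists_mulVec_eq_zero_iff.1 ⟨fun _ => 1, ?_, ?_⟩
    · exact fun h => one_ne_zero (congrFun h t)
    · ext u
      simp only [Matrix.mulVec, dotProduct, mul_one, Pi.zero_apply]
      by_cases hu : u = t
      · subst hu
        simp [Matrix.updateRow_self]
      · simp [Matrix.updateRow_ne hu, hrow, Matrix.one_apply]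
  have h5 : (fun _ => 1 : V → ℚ) = ∑ w, Pi.single w 1 := by
    ext w
    simp [Finset.sum_apply, Pi.single_apply]
  rw [h3, h5, ← Matrix.cramer_transpose_apply, map_sum, Finset.sum_apply] at h2
  simp only [Matrix.cramer_transpose_apply, h4, Finset.sum_const, Finset.card_univ,
    nsmul_eq_mul, ← hNdef] at h2
  rw [eq_div_iff hN, mul_comm, h2]

/-! ### The de Bruijn graph on words of length `n` and its trail counts. -/

section Shift

variable {Ω : Type*}

/-- The words of length `n`. -/
abbrev Word (Ω : Type*) (n : ℕ) : Type _ := {l : List Ω // l.length = n}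

instance [Fintype Ω] (n : ℕ) : Fintype (Word Ω n) :=
  inferInstanceAs (Fintype (List.Vector Ω n))

theorem card_word [Fintype Ω] (n : ℕ) : Fintype.card (Word Ω n) = Fintype.card Ω ^ n :=
  card_vector n

/-- The transition function of the de Bruijn graph on words of length `n`. -/
def shift {n : ℕ} (v : Word Ω n) (a : Ω) : Word Ω n :=
  ⟨(v.1 ++ [a]).tail, by simp [v.2]⟩

theorem shift_val {n : ℕ} (v : Word Ω n) (a : Ω) :
    (shift v a).1 = (v.1 ++ [a]).tail := rfl

variable [Fintype Ω] [DecidableEq Ω] {n : ℕ}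

theorem card_shift_eq (u : Word Ω n) :
    ((Finset.univ : Finset (Word Ω n × Ω)).filter fun p => shift p.1 p.2 = u).card =
      Fintype.card Ω := by
  rw [← Finset.card_univ (α := Ω)]
  symm
  -- An edge into `u` is a word `a :: u`, read as its initial `n` letters followed by its last
  -- letter; this also covers `n = 0`.
  refine Finset.card_bij
    (fun a _ => (⟨(a :: u.1).dropLast, by simp [u.2]⟩, (a :: u.1).getLast (by simp))) ?_ ?_ ?_
  · intro a _
    simp only [Finset.mem_filter, Finset.mem_univ, true_and]
    apply Subtype.ext
    rw [shift_val, List.dropLast_append_getLast, List.tail_cons]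
  · intro a _ b _ h
    simp only [Prod.mk.injEq] at h
    have h1 : (a :: u.1).dropLast = (b :: u.1).dropLast := congrArg Subtype.val h.1
    have h2 : a :: u.1 = b :: u.1 := by
      rw [← List.dropLast_append_getLast (l := a :: u.1) (by simp),
        ← List.dropLast_append_getLast (l := b :: u.1) (by simp), h1, h.2]
    exact (List.cons.inj h2).1
  · rintro ⟨p, b⟩ hp
    simp only [Finset.mem_filter, Finset.mem_univ, true_and] at hp
    have hne : p.1 ++ [b] ≠ [] := by simp
    have h1 : (p.1 ++ [b]).head hne :: u.1 = p.1 ++ [b] := by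
      rw [← hp]
      exact List.cons_head_tail hne
    refine ⟨(p.1 ++ [b]).head hne, Finset.mem_univ _, ?_⟩
    refine Prod.ext (Subtype.ext ?_) ?_
    · simp only [h1, List.dropLast_concat]
    · simp only [h1, List.getLast_append_singleton]

theorem sum_shift_eq {R : Type*} [Semiring R] (u : Word Ω n) (x : R) :
    ∑ p, ∑ b, (if shift p b = u then x else 0) = (Fintype.card Ω : R) * x := by
  rw [← Fintype.sum_prod_type' (f := fun p b => if shift p b = u then x else 0),
    ← Finset.sum_filter, Finset.sum_const, card_shift_eq, nsmul_eq_mul]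

theorem balanced_const_iff (m : ℕ) (v t : Word Ω n) :
    Balanced shift (fun _ (_ : Ω) => m) v t ↔ v = t := by
  have h1 : ∀ u : Word Ω n, ∑ p, ∑ b, (if shift p b = u then m else 0) =
      ∑ _b : Ω, m := by
    intro u
    rw [sum_shift_eq]
    simp
  unfold Balanced
  simp only [h1, add_right_inj]
  constructor
  · intro h
    by_contra hne
    simpa [hne] using h v
  · rintro rfl u
    rfl

variable [Nonempty Ω]

theorem transMatrix_const {m : ℕ} (hm : 1 ≤ m) (u w : Word Ω n) :
    transMatrix shift (fun _ (_ : Ω) => m) u w =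
      ∑ a, if shift u a = w then 1 / (Fintype.card Ω : ℚ) else 0 := by
  have hm' : (m : ℚ) ≠ 0 := by exact_mod_cast (by omega : m ≠ 0)
  simp only [transMatrix, Matrix.of_apply, Finset.sum_const, Finset.card_univ, smul_eq_mul]
  push_cast
  simp only [div_mul_cancel_right₀ hm', one_div]

/-- Each step of the walk pushes out the oldest letter, so `j` steps forget the first `j` letters.
-/
theorem transMatrix_pow_apply_eq {m : ℕ} (hm : 1 ≤ m) (j : ℕ) (u u' w : Word Ω n)
    (h : u.1.drop j = u'.1.drop j) :
    (transMatrix shift (fun _ (_ : Ω) => m) ^ j) u w =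
      (transMatrix shift (fun _ (_ : Ω) => m) ^ j) u' w := by
  induction j generalizing u u' with
  | zero =>
    have : u = u' := Subtype.ext (by simpa using h)
    rw [this]
  | succ j ih =>
    have key : ∀ u : Word Ω n,
        (transMatrix shift (fun _ (_ : Ω) => m) ^ (j + 1)) u w =
        ∑ a, 1 / (Fintype.card Ω : ℚ) *
          (transMatrix shift (fun _ (_ : Ω) => m) ^ j) (shift u a) w := by
      intro u
      rw [pow_succ', Matrix.mul_apply]
      simp only [transMatrix_const hm, Finset.sum_mul]
      rw [Finset.sum_comm]
      simp [ite_mul]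
    rw [key, key]
    refine Finset.sum_congr rfl fun a _ => ?_
    congr 1
    apply ih
    rw [shift_val, shift_val, List.drop_tail, List.drop_tail, List.drop_append,
      List.drop_append, h, u.2, u'.2]

theorem rootedDet_const {m : ℕ} (hm : 1 ≤ m) (t : Word Ω n) :
    rootedDet shift (fun _ (_ : Ω) => m) t = 1 / (Fintype.card Ω : ℚ) ^ n := by
  have hq : (Fintype.card Ω : ℚ) ≠ 0 := by exact_mod_cast Fintype.card_ne_zero
  rw [rootedDet, det_updateRow_one_sub (n := n), card_word, Nat.cast_pow]
  · intro u
    simp only [transMatrix_const hm]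
    rw [Finset.sum_comm]
    simp [hq]
  · intro w
    simp only [transMatrix_const hm]
    rw [sum_shift_eq]
    field_simp
  · intro u u' w
    exact transMatrix_pow_apply_eq hm n u u' w
      (by rw [List.drop_of_length_le u.2.le, List.drop_of_length_le u'.2.le])

theorem ncard_trails_const {m : ℕ} (hm : 1 ≤ m) (v : Word Ω n) :
    (Fintype.card Ω : ℚ) ^ n * ((trails shift v (fun _ (_ : Ω) => m)).ncard : ℚ) =
      W m (Fintype.card Ω) (n + 1) := by
  have hq : (Fintype.card Ω : ℚ) ≠ 0 := by exact_mod_cast Fintype.card_ne_zero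
  have h := ncard_trails_mul_prod shift ((balanced_const_iff m v v).2 rfl)
  rw [rootedDet_const hm] at h
  simp only [Finset.prod_const, Finset.card_univ, card_word, Finset.sum_const, smul_eq_mul,
    ← pow_mul] at h
  rw [W, eq_div_iff (by positivity), mul_assoc, Nat.add_sub_cancel, pow_succ (Fintype.card Ω) n,
    mul_comm (Fintype.card Ω ^ n) (Fintype.card Ω), mul_comm m]
  push_cast at h
  rw [h]
  field_simp

/-- Only row `v` of the Laplacian changes, and `v` is also the end of the trail, where the row is
overwritten. The factorials lose `m` and `mq`, which accounts for the extra factor `q`. -/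
theorem ncard_trails_const_sub_unitCount {m : ℕ} (hm : 1 ≤ m) (v : Word Ω n) (a : Ω) :
    (Fintype.card Ω : ℚ) ^ (n + 1) *
      ((trails shift (shift v a) ((fun _ _ => m) - unitCount v a)).ncard : ℚ) =
      W m (Fintype.card Ω) (n + 1) := by
  have hq : (Fintype.card Ω : ℚ) ≠ 0 := by exact_mod_cast Fintype.card_ne_zero
  have hm' : (m : ℚ) ≠ 0 := by exact_mod_cast (by omega : m ≠ 0)
  have hpos : 0 < (fun (_ : Word Ω n) (_ : Ω) => m) v a := hm
  have hb : Balanced shift ((fun _ (_ : Ω) => m) - unitCount v a) (shift v a) v := by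
    rw [← balanced_unitCount_add, unitCount_add_sub hpos, balanced_const_iff]
  have h := ncard_trails_mul_prod shift hb
  have hroot : rootedDet shift ((fun _ (_ : Ω) => m) - unitCount v a) v =
      1 / (Fintype.card Ω : ℚ) ^ n := by
    rw [← rootedDet_const hm v]
    exact rootedDet_congr shift fun u hu => by ext b; simp [unitCount, hu]
  rw [hroot] at h
  have e1 := prod_factorial_sub_unitCount
    (c := fun (_ : Word Ω n) (_ : Ω) => m) (v := v) (a := a) hpos
  have e2 := prod_factorial_sum_sub_unitCount
    (c := fun (_ : Word Ω n) (_ : Ω) => m) (v := v) (a := a) hpos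
  simp only [Finset.prod_const, Finset.card_univ, card_word, Finset.sum_const, smul_eq_mul,
    ← pow_mul] at e1 e2
  rw [W, eq_div_iff (by positivity), Nat.add_sub_cancel, pow_succ (Fintype.card Ω) n,
    mul_comm (Fintype.card Ω ^ n) (Fintype.card Ω), mul_comm m]
  have e1' := congrArg (Nat.cast : ℕ → ℚ) e1
  have e2' := congrArg (Nat.cast : ℕ → ℚ) e2
  rw [Nat.cast_mul, Nat.cast_pow] at e1'
  rw [Nat.cast_mul, Nat.cast_pow, Nat.cast_mul] at e2'
  rw [e1', e2', pow_succ, mul_assoc, mul_left_comm _ (m : ℚ), h]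
  field_simp

end Shift

/-! ### Linear sequences as trails. -/

section Linear

variable {Ω : Type*} [DecidableEq Ω]

theorem linOcc_cons (y s : List Ω) (b : Ω) :
    linOcc y (b :: s) = (if y <+: b :: s then 1 else 0) + linOcc y s := by
  simp only [linOcc, Finset.card_filter]
  rw [List.length_cons, Finset.sum_range_succ', add_comm]
  simp

theorem linOcc_eq_zero {y s : List Ω} (h : s.length < y.length) : linOcc y s = 0 := by
  rw [linOcc, Finset.card_eq_zero, Finset.filter_eq_empty_iff]
  intro i _ hp
  have := hp.length_le
  rw [List.length_drop] at this
  omega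

theorem concat_prefix_append_cons_iff {n : ℕ} (u v : Word Ω n) (a b : Ω) (x : List Ω) :
    u.1 ++ [b] <+: v.1 ++ a :: x ↔ u = v ∧ b = a := by
  constructor
  · rintro ⟨r, hr⟩
    rw [List.append_assoc] at hr
    obtain ⟨h1, h2⟩ := List.append_inj hr (u.2.trans v.2.symm)
    exact ⟨Subtype.ext h1, (List.cons.inj h2).1⟩
  · rintro ⟨rfl, rfl⟩
    exact ⟨x, by simp⟩

theorem linOcc_append {n : ℕ} (u v : Word Ω n) (b : Ω) (x : List Ω) :
    linOcc (u.1 ++ [b]) (v.1 ++ x) = transCount shift v x u b := by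
  induction x generalizing v with
  | nil =>
    rw [linOcc_eq_zero (by simp [u.2, v.2])]
    rfl
  | cons a x ih =>
    have hne : v.1 ++ [a] ≠ [] := by simp
    have h1 : v.1 ++ a :: x = (v.1 ++ [a]).head hne :: ((shift v a).1 ++ x) := by
      rw [shift_val, ← List.cons_append, List.cons_head_tail]
      simp
    simp only [transCount, Pi.add_apply, unitCount, ← ih]
    simp only [← concat_prefix_append_cons_iff u v a b x]
    rw [h1, linOcc_cons]

theorem foldl_shift_val {n : ℕ} (v : Word Ω n) (x : List Ω) :
    (x.foldl shift v).1 = (v.1 ++ x).drop x.length := by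
  induction x generalizing v with
  | nil => simp
  | cons a x ih =>
    have hne : v.1 ++ [a] ≠ [] := by simp
    rw [List.foldl_cons, ih, shift_val, List.length_cons, ← List.drop_tail,
      List.append_cons v.1 a x, List.tail_append_of_ne_nil hne]

theorem exists_eq_concat {n : ℕ} {y : List Ω} (hy : y.length = n + 1) :
    ∃ (u : Word Ω n) (b : Ω), y = u.1 ++ [b] := by
  have hne : y ≠ [] := by
    rintro rfl
    simp at hy
  exact ⟨⟨y.dropLast, by simp [hy]⟩, y.getLast hne, (List.dropLast_append_getLast hne).symm⟩

variable [Fintype Ω]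

theorem forall_linOcc_iff {n m : ℕ} (v : Word Ω n) (x : List Ω) :
    (∀ y : List Ω, y.length = n + 1 → linOcc y (v.1 ++ x) = m) ↔
      x ∈ trails shift v (fun _ _ => m) := by
  constructor
  · intro h
    ext u b
    rw [← linOcc_append]
    exact h _ (by simp [u.2])
  · intro h y hy
    obtain ⟨u, b, rfl⟩ := exists_eq_concat hy
    rw [linOcc_append]
    exact congrFun (congrFun h u) b

/-- The length condition comes for free: the edge counts add up to `|x|`. -/
theorem append_mem_linearSeqs_iff {n m : ℕ} (v : Word Ω n) (x : List Ω) :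
    v.1 ++ x ∈ linearSeqs Ω m (n + 1) ↔ x ∈ trails shift v (fun _ _ => m) := by
  rw [← forall_linOcc_iff]
  refine ⟨fun h => h.2, fun h => ⟨?_, h⟩⟩
  have h1 := sum_transCount shift v x
  rw [(forall_linOcc_iff v x).1 h] at h1
  simp only [Finset.sum_const, Finset.card_univ, card_word, smul_eq_mul] at h1
  rw [List.length_append, v.2, ← h1, Nat.add_sub_cancel, pow_succ]
  ring

theorem exists_eq_append {n : ℕ} {s : List Ω} (hs : n ≤ s.length) :
    ∃ (v : Word Ω n) (x : List Ω), s = v.1 ++ x :=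
  ⟨⟨s.take n, by simp [hs]⟩, s.drop n, (List.take_append_drop n s).symm⟩

theorem exists_eq_append_of_mem {n m : ℕ} {s : List Ω} (hs : s ∈ linearSeqs Ω m (n + 1)) :
    ∃ (v : Word Ω n) (x : List Ω), s = v.1 ++ x :=
  exists_eq_append (by rw [hs.1]; omega)

theorem linearSeqs_eq_iUnion (n m : ℕ) :
    linearSeqs Ω m (n + 1) =
      ⋃ v : Word Ω n, (fun x => v.1 ++ x) '' trails shift v (fun _ _ => m) := by
  ext s
  simp only [Set.mem_iUnion, Set.mem_image]
  constructor
  · intro hs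
    obtain ⟨v, x, rfl⟩ := exists_eq_append_of_mem hs
    exact ⟨v, x, (append_mem_linearSeqs_iff v x).1 hs, rfl⟩
  · rintro ⟨v, x, hx, rfl⟩
    exact (append_mem_linearSeqs_iff v x).2 hx

theorem linearSeqsFrom_eq_image {n m : ℕ} (hm : 1 ≤ m) (u : Word Ω n) (b : Ω) :
    linearSeqsFrom Ω m (n + 1) (u.1 ++ [b]) =
      (fun x => u.1 ++ b :: x) '' trails shift (shift u b) ((fun _ _ => m) - unitCount u b) := by
  ext s
  simp only [Set.mem_image]
  constructor
  · rintro ⟨hs, hp⟩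
    obtain ⟨v, x, rfl⟩ := exists_eq_append_of_mem hs
    rw [append_mem_linearSeqs_iff] at hs
    cases x with
    | nil =>
      have := hp.length_le
      simp [u.2, v.2] at this
    | cons a x =>
      obtain ⟨rfl, rfl⟩ := (concat_prefix_append_cons_iff u v a b x).1 hp
      exact ⟨x, ((cons_mem_trails shift).1 hs).2, rfl⟩
  · rintro ⟨x, hx, rfl⟩
    refine ⟨(append_mem_linearSeqs_iff u _).2 ((cons_mem_trails shift).2 ⟨hm, hx⟩), ?_⟩
    exact (concat_prefix_append_cons_iff u u b b x).2 ⟨rfl, rfl⟩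

/-- The last `n` letters are the state reached at the end, and constant edge counts force it to be
the initial state. -/
theorem take_eq_drop_of_mem_linearSeqs {n m : ℕ} {s : List Ω}
    (hs : s ∈ linearSeqs Ω m (n + 1)) : s.take n = s.drop (s.length - n) := by
  obtain ⟨v, x, rfl⟩ := exists_eq_append_of_mem hs
  have hx := (append_mem_linearSeqs_iff v x).1 hs
  have hb := balanced_transCount shift v x
  rw [show transCount shift v x = fun _ _ => m from hx, balanced_const_iff] at hb
  have h1 := foldl_shift_val v x
  rw [← hb] at h1
  rw [List.length_append, v.2, Nat.add_sub_cancel_left, ← h1]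
  exact List.take_left' v.2

variable [Nonempty Ω]

theorem ncard_linearSeqs (n : ℕ) {m : ℕ} (hm : 1 ≤ m) :
    ((linearSeqs Ω m (n + 1)).ncard : ℚ) = W m (Fintype.card Ω) (n + 1) := by
  have hq : (Fintype.card Ω : ℚ) ≠ 0 := by exact_mod_cast Fintype.card_ne_zero
  rw [linearSeqs_eq_iUnion, Set.ncard_iUnion_of_finite, finsum_eq_sum_of_fintype, Nat.cast_sum]
  · have h : ∀ v : Word Ω n,
        (((fun x => v.1 ++ x) '' trails shift v (fun _ (_ : Ω) => m)).ncard : ℚ) =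
          W m (Fintype.card Ω) (n + 1) / (Fintype.card Ω : ℚ) ^ n := by
      intro v
      rw [Set.ncard_image_of_injective _ (List.append_right_injective v.1),
        ← ncard_trails_const hm v]
      field_simp
    simp only [h, Finset.sum_const, Finset.card_univ, card_word, nsmul_eq_mul]
    push_cast
    field_simp
  · exact fun v => (trails_finite shift v _).image _
  · intro v w hvw
    rw [Function.onFun, Set.disjoint_left]
    rintro _ ⟨x, _, rfl⟩ ⟨y, _, h⟩
    exact hvw (Subtype.ext (List.append_inj h (w.2.trans v.2.symm)).1.symm)

theorem ncard_linearSeqsFrom {n m : ℕ} (hm : 1 ≤ m) {y : List Ω} (hy : y.length = n + 1) :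
    (Fintype.card Ω : ℚ) ^ (n + 1) * ((linearSeqsFrom Ω m (n + 1) y).ncard : ℚ) =
      W m (Fintype.card Ω) (n + 1) := by
  obtain ⟨u, b, rfl⟩ := exists_eq_concat hy
  rw [linearSeqsFrom_eq_image hm, Set.ncard_image_of_injective,
    ncard_trails_const_sub_unitCount hm]
  intro x x' h
  simpa using h

end Linear

/-! ### Cyclic sequences and unrolling. -/

section Cyclic

variable {Ω : Type*}

/-- `s'` is obtained by reading `n` letters more than one full turn around the circle `s`. -/
def Wraps (n : ℕ) (s s' : List Ω) : Prop :=
  s'.length = s.length + n ∧ ∀ i < s.length + n, s'[i]? = s[i % s.length]?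

theorem exists_wraps (n : ℕ) {s : List Ω} (hs : s ≠ []) : ∃ s', Wraps n s s' := by
  have hpos := List.length_pos_iff.2 hs
  refine ⟨List.ofFn fun i : Fin (s.length + n) => s[i.1 % s.length]'(Nat.mod_lt _ hpos),
    by simp, fun i hi => ?_⟩
  rw [List.getElem?_eq_getElem (by simpa using hi), List.getElem_ofFn,
    List.getElem?_eq_getElem (Nat.mod_lt _ hpos)]

theorem Wraps.unique {n : ℕ} {s s' t' : List Ω} (h : Wraps n s s') (h' : Wraps n s t') :
    s' = t' := by
  refine List.ext_getElem? fun i => ?_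
  by_cases hi : i < s.length + n
  · rw [h.2 i hi, h'.2 i hi]
  · rw [List.getElem?_eq_none (by rw [h.1]; omega), List.getElem?_eq_none (by rw [h'.1]; omega)]

theorem Wraps.rdrop_eq {n : ℕ} {s s' : List Ω} (h : Wraps n s s') : s'.rdrop n = s := by
  rw [List.rdrop, h.1, Nat.add_sub_cancel]
  refine List.ext_getElem? fun i => ?_
  by_cases hi : i < s.length
  · rw [List.getElem?_take_of_lt hi, h.2 i (by omega), Nat.mod_eq_of_lt hi]
  · rw [List.getElem?_eq_none (by simp; omega), List.getElem?_eq_none (by omega)]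

theorem wraps_rdrop {n : ℕ} {s : List Ω} (hn : n < s.length)
    (h : s.take n = s.drop (s.length - n)) : Wraps n (s.rdrop n) s := by
  have hlen : (s.rdrop n).length = s.length - n := by simp [List.rdrop]
  refine ⟨by omega, fun i hi => ?_⟩
  -- A border of length `n` is a period `s.length - n`. The border may overlap itself several times,
  -- so indices are lowered by one period at a time.
  induction i using Nat.strong_induction_on with
  | _ i ih =>
    rw [hlen] at hi ih ⊢
    by_cases hlt : i < s.length - n
    · rw [Nat.mod_eq_of_lt hlt, List.rdrop, List.getElem?_take_of_lt hlt]
    · have h1 : s[i]? = s[i - (s.length - n)]? := by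
        have h2 := congrArg (fun l : List Ω => l[i - (s.length - n)]?) h
        simp only [List.getElem?_drop] at h2
        rw [List.getElem?_take_of_lt (by omega),
          show s.length - n + (i - (s.length - n)) = i by omega] at h2
        exact h2.symm
      rw [h1, ih _ (by omega) (by omega), ← Nat.mod_eq_sub_mod (by omega)]

variable [DecidableEq Ω]

theorem Wraps.prefix_drop_iff {n : ℕ} {s s' : List Ω} (h : Wraps n s s') {y : List Ω}
    (hy : y.length = n + 1) {i : ℕ} (hi : i < s.length) :
    y <+: s'.drop i ↔ CycOccAt y s i := by
  rw [List.prefix_iff_getElem?, CycOccAt]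
  refine forall₂_congr fun j hj => ?_
  rw [List.getElem?_drop, h.2 _ (by omega), List.getElem?_eq_getElem hj]

theorem Wraps.linOcc_eq {n : ℕ} {s s' : List Ω} (h : Wraps n s s') {y : List Ω}
    (hy : y.length = n + 1) : linOcc y s' = cycOccList y s := by
  unfold linOcc cycOccList
  congr 1
  ext i
  simp only [Finset.mem_filter, Finset.mem_range]
  constructor
  · rintro ⟨_, hp⟩
    have h1 := hp.length_le
    have h2 := h.1
    rw [List.length_drop] at h1
    have hi : i < s.length := by omega
    exact ⟨hi, (h.prefix_drop_iff hy hi).1 hp⟩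
  · rintro ⟨hi, hp⟩
    exact ⟨by have := h.1; omega, (h.prefix_drop_iff hy hi).2 hp⟩

theorem mem_linearizedSeqs_iff {m k : ℕ} {s : List Ω} :
    s ∈ linearizedSeqs Ω m k ↔ ∀ y : List Ω, y.length = k → cycOccList y s = m := by
  constructor
  · rintro ⟨c, hc, rfl⟩
    exact hc
  · intro h
    exact ⟨s, h, rfl⟩

variable [Fintype Ω]

theorem Wraps.mem_linearSeqs_iff {n m : ℕ} {s s' : List Ω} (h : Wraps n s s') :
    s' ∈ linearSeqs Ω m (n + 1) ↔ s ∈ linearizedSeqs Ω m (n + 1) := by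
  obtain ⟨v, x, rfl⟩ := exists_eq_append (n := n) (s := s') (by rw [h.1]; omega)
  rw [append_mem_linearSeqs_iff, ← forall_linOcc_iff, mem_linearizedSeqs_iff]
  exact forall₂_congr fun y hy => by rw [h.linOcc_eq hy]

variable [Nonempty Ω]

theorem wraps_of_mem_linearSeqs {n m : ℕ} (hm : 1 ≤ m) {s : List Ω}
    (hs : s ∈ linearSeqs Ω m (n + 1)) : Wraps n (s.rdrop n) s := by
  refine wraps_rdrop ?_ (take_eq_drop_of_mem_linearSeqs hs)
  have : 0 < m * Fintype.card Ω ^ (n + 1) := Nat.mul_pos hm (pow_pos Fintype.card_pos _)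
  rw [hs.1]
  omega

theorem ne_nil_of_mem_linearizedSeqs {n m : ℕ} (hm : 1 ≤ m) {s : List Ω}
    (hs : s ∈ linearizedSeqs Ω m n) : s ≠ [] := by
  rintro rfl
  have h := mem_linearizedSeqs_iff.1 hs (List.replicate n (Classical.arbitrary Ω)) (by simp)
  simp [cycOccList] at h
  omega

theorem bijOn_rdrop (n : ℕ) {m : ℕ} (hm : 1 ≤ m) :
    Set.BijOn (fun s : List Ω => s.rdrop n) (linearSeqs Ω m (n + 1))
      (linearizedSeqs Ω m (n + 1)) := by
  refine ⟨fun s hs => ?_, fun s hs t ht hst => ?_, fun s hs => ?_⟩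
  · have hw := wraps_of_mem_linearSeqs hm hs
    exact hw.mem_linearSeqs_iff.1 hs
  · have h1 := wraps_of_mem_linearSeqs hm hs
    have h2 := wraps_of_mem_linearSeqs hm ht
    simp only at hst
    rw [hst] at h1
    exact h1.unique h2
  · obtain ⟨s', h⟩ := exists_wraps n (ne_nil_of_mem_linearizedSeqs hm hs)
    exact ⟨s', h.mem_linearSeqs_iff.2 hs, h.rdrop_eq⟩

theorem bijOn_rdrop_from {n m : ℕ} (hm : 1 ≤ m) {y : List Ω} (hy : y.length = n + 1) :
    Set.BijOn (fun s : List Ω => s.rdrop n) (linearSeqsFrom Ω m (n + 1) y)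
      (linearizedSeqsFrom Ω m (n + 1) y) := by
  have hb := bijOn_rdrop (Ω := Ω) n hm
  have key : ∀ s ∈ linearSeqs Ω m (n + 1), (y <+: s ↔ CycOccAt y (s.rdrop n) 0) := by
    intro s hs
    have hne := ne_nil_of_mem_linearizedSeqs hm (hb.mapsTo hs)
    exact (wraps_of_mem_linearSeqs hm hs).prefix_drop_iff hy (List.length_pos_iff.2 hne)
  refine ⟨fun s hs => ⟨hb.mapsTo hs.1, (key s hs.1).1 hs.2⟩, hb.injOn.mono fun s hs => hs.1,
    fun t ht => ?_⟩
  obtain ⟨s, hs, rfl⟩ := hb.surjOn ht.1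
  exact ⟨s, ⟨hs, (key s hs).2 ht.2⟩, rfl⟩

theorem length_of_mem_linearizedSeqs {n m : ℕ} (hm : 1 ≤ m) {s : List Ω}
    (hs : s ∈ linearizedSeqs Ω m (n + 1)) : s.length = m * Fintype.card Ω ^ (n + 1) := by
  obtain ⟨s', hs', rfl⟩ := (bijOn_rdrop n hm).surjOn hs
  simp [List.rdrop, hs'.1]

theorem invOn_append_take {n m : ℕ} (hm : 1 ≤ m) (hq : 2 ≤ Fintype.card Ω) :
    Set.InvOn (fun s : List Ω => s ++ s.take n) (fun s : List Ω => s.rdrop n)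
      (linearSeqs Ω m (n + 1)) (linearizedSeqs Ω m (n + 1)) := by
  -- Here `q ≥ 2` enters: the circle has at least `n` letters, so `s.take n` really has length `n`.
  -- For `q = 1` the circle has only `m` letters and may be shorter.
  have hle : n ≤ m * Fintype.card Ω ^ (n + 1) :=
    calc n ≤ n + 1 := Nat.le_succ n
      _ ≤ Fintype.card Ω ^ (n + 1) := (Nat.lt_pow_self (by omega)).le
      _ ≤ m * Fintype.card Ω ^ (n + 1) := Nat.le_mul_of_pos_left _ hm
  constructor
  · intro s hs
    have h1 := take_eq_drop_of_mem_linearSeqs hs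
    have h2 : n ≤ s.length - n := by rw [hs.1]; omega
    simp only [List.rdrop]
    rw [List.take_take, min_eq_left h2, h1, List.take_append_drop]
  · intro s hs
    have h1 := length_of_mem_linearizedSeqs hm hs
    simp only [List.rdrop, List.length_append, List.length_take]
    rw [min_eq_left (by omega), Nat.add_sub_cancel, List.take_left]

end Cyclic

end MultiDeBruijn

theorem mainTheorem3 {Ω : Type*} [Fintype Ω] [DecidableEq Ω] [Nonempty Ω]
    (m k : ℕ) (hm : 1 ≤ m) (hk : 1 ≤ k) :
    (2 ≤ Fintype.card Ω →
      (∀ s ∈ MultiDeBruijn.linearSeqs Ω m k, s.take (k - 1) = s.rtake (k - 1)) ∧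
      Set.BijOn (fun s : List Ω => s.rdrop (k - 1))
        (MultiDeBruijn.linearSeqs Ω m k) (MultiDeBruijn.linearizedSeqs Ω m k) ∧
      Set.InvOn (fun s : List Ω => s ++ s.take (k - 1)) (fun s : List Ω => s.rdrop (k - 1))
        (MultiDeBruijn.linearSeqs Ω m k) (MultiDeBruijn.linearizedSeqs Ω m k)) ∧
    (((MultiDeBruijn.linearSeqs Ω m k).ncard : ℚ) = MultiDeBruijn.W m (Fintype.card Ω) k ∧
      ((MultiDeBruijn.linearizedSeqs Ω m k).ncard : ℚ) = MultiDeBruijn.W m (Fintype.card Ω) k ∧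
      ∀ y : List Ω, y.length = k →
        (MultiDeBruijn.linearSeqsFrom Ω m k y).ncard =
            (MultiDeBruijn.linearizedSeqsFrom Ω m k y).ncard ∧
          (Fintype.card Ω : ℚ) ^ k * ((MultiDeBruijn.linearizedSeqsFrom Ω m k y).ncard : ℚ) =
            MultiDeBruijn.W m (Fintype.card Ω) k) := by
  obtain ⟨n, rfl⟩ : ∃ n, k = n + 1 := ⟨k - 1, by omega⟩
  rw [Nat.add_sub_cancel]
  refine ⟨fun hq => ⟨fun s hs => MultiDeBruijn.take_eq_drop_of_mem_linearSeqs hs,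
    MultiDeBruijn.bijOn_rdrop n hm, MultiDeBruijn.invOn_append_take hm hq⟩,
    MultiDeBruijn.ncard_linearSeqs n hm, ?_, fun y hy => ?_⟩
  · rw [← (MultiDeBruijn.bijOn_rdrop n hm).ncard_eq]
    exact MultiDeBruijn.ncard_linearSeqs n hm
  · have h := (MultiDeBruijn.bijOn_rdrop_from hm hy).ncard_eq
    exact ⟨h, h ▸ MultiDeBruijn.ncard_linearSeqsFrom hm hy⟩
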